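/- Let $\mathfrak B$ be a Banach space over $\mathbb R$ or $\mathbb C$, let $[\mathfrak B]$ be the Banach space of bounded linear operators on $\mathfrak B$ with the operator norm, and let all spaces $C(\cdot,\cdot)$ of continuous maps carry the compact-open topology. For $\varphi\in C(\mathbb R,X)$ and $h\in\mathbb R$ put $\varphi^h(t):=\varphi(t+h)$, and for $G\in C(\mathbb R\times W,X)$ put $G^h(t,x):=G(t+h,x)$. A function is called Lagrange stable if the set of all its shifts is precompact. For a function, or a tuple $g$ of functions, let $\mathfrak L_g$ be the set of all real sequences $\{t_n\}$ with $t_n\to+\infty$ or $t_n\to-\infty$ such that $\{g^{t_n}\}$ converges. Let $A\in C(\mathbb R,[\mathfrak B])$, $f\in C(\mathbb R,\mathfrak B)$ and $F\in C(\mathbb R\times\mathfrak B,\mathfrak B)$ be Lagrange stable, with $F(t,0)=0$ for all $t$. Let $U(t)$ be the Cauchy operator of $x'=A(t)x$, i.e. $U'(t)=A(t)U(t)$ and $U(0)=I$. Suppose that this equation has an exponential trichotomy on $\mathbb R$: there are projections $P,Q\in[\mathfrak B]$ with $PQ=QP$ and $P+Q-PQ=I$, and constants $\mathcal N\ge 1$,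 $\nu>0$, such that $$\|U(t)PU^{-1}(\tau)\|\le \mathcal N e^{-\nu(t-\tau)}\ (0\le\tau\le t),\qquad \|U(t)(I-P)U^{-1}(\tau)\|\le \mathcal N e^{-\nu(\tau-t)}\ (t\le\tau,\ \tau\ge0),$$ $$\|U(t)QU^{-1}(\tau)\|\le \mathcal N e^{-\nu(\tau-t)}\ (t\le\tau\le0),\qquad \|U(t)(I-Q)U^{-1}(\tau)\|\le \mathcal N e^{-\nu(t-\tau)}\ (\tau\le t,\ \tau\le0).$$ Let $G_A(t,\tau)$ be the corresponding Green function, equal to $U(t)PU^{-1}(\tau)$ for $0\le\tau<t$, to $-U(t)(I-P)U^{-1}(\tau)$ for $\tau\ge0$, $t\le\tau$, to $-U(t)QU^{-1}(\tau)$ for $t\le\tau<0$, and to $U(t)(I-Q)U^{-1}(\tau)$ for $\tau<0$, $\tau<t$. Assume Condition (C): the family $\{U(t)PU^{-1}(t)\}_{t\in\mathbb R}$ is precompact in $[\mathfrak B]$. Finally, let $F$ satisfy $|F(t,u_1)-F(t,u_2)|\le L|u_1-u_2|$ for all $t\in\mathbb R$ and $u_1,u_2\in\mathfrak B$, with a constant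 $L<\nu/(2\mathcal N)$. Then there is exactly one Lagrange stable $\varphi\in C(\mathbb R,\mathfrak B)$ that satisfies, for all $t\in\mathbb R$, $$\varphi(t)=\int_{-\infty}^{+\infty}G_A(t,\tau)\,[f(\tau)+F(\tau,\varphi(\tau))]\,d\tau$$ (the integral being absolutely convergent). This $\varphi$ is a solution on $\mathbb R$ of $u'=A(t)u+f(t)+F(t,u)$, and it is remotely compatible: with $Q_\varphi:=\overline{\varphi(\mathbb R)}$ and $F_{Q_\varphi}:=F|_{\mathbb R\times Q_\varphi}$, $$\mathfrak L_{(A,f,F_{Q_\varphi})}\subseteq\mathfrak L_\varphi .$$ -/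

import Mathlib

open Filter Topology

noncomputable section

namespace RemoteCompat

/-! ### Shift dynamical systems, Lagrange stability, sequences of convergence -/

section Flow

variable {Z : Type*} [TopologicalSpace Z]

/-- The point `z` is Lagrange stable for the shift `π`: its trajectory is precompact. -/
def LagrangeStable (π : ℝ → Z → Z) (z : Z) : Prop :=
  IsCompact (closure (Set.range fun t : ℝ => π t z))

/-- The family of all real sequences `t n` with `t n → +∞` or `t n → -∞` along which
`π (t n) z` converges. -/
def limitSeqs (π : ℝ → Z → Z) (z : Z) : Set (ℕ → ℝ) :=
  {t | (Tendsto t atTop atTop ∨ Tendsto t atTop atBot) ∧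
    ∃ y : Z, Tendsto (fun n => π (t n) z) atTop (𝓝 y)}

end Flow

section Shift

variable {X W : Type*} [TopologicalSpace X] [TopologicalSpace W]

/-- The shift `φ ↦ φ(· + h)` on `C(ℝ, X)` (compact-open topology). -/
def shift (h : ℝ) (φ : C(ℝ, X)) : C(ℝ, X) :=
  φ.comp ⟨fun t => t + h, by fun_prop⟩

/-- The shift in time `f ↦ f(· + h, ·)` on `C(ℝ × W, X)` (compact-open topology). -/
def shiftTime (h : ℝ) (f : C(ℝ × W, X)) : C(ℝ × W, X) :=
  f.comp ⟨fun p => (p.1 + h, p.2), by fun_prop⟩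

/-- The restriction of `F` to `ℝ × Q`. -/
def restrictTo (Q : Set W) (F : C(ℝ × W, X)) : C(ℝ × Q, X) :=
  F.comp ⟨fun p => (p.1, (p.2 : W)), by fun_prop⟩

/-- The simultaneous shift on a triple `(A, f, G)`. -/
def shiftTriple {X₁ X₂ : Type*} [TopologicalSpace X₁] [TopologicalSpace X₂] (h : ℝ)
    (z : C(ℝ, X₁) × C(ℝ, X₂) × C(ℝ × W, X)) : C(ℝ, X₁) × C(ℝ, X₂) × C(ℝ × W, X) :=
  (shift h z.1, shift h z.2.1, shiftTime h z.2.2)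

end Shift

/-! ### Global solvability of linear equations -/

section LinearODE

variable {V : Type*} [NormedAddCommGroup V] [NormedSpace ℝ V]

/-- The terms of the Peano–Baker series of `x' = L t x`, `x 0 = x₀`. -/
def seriesTerm (L : C(ℝ, V →L[ℝ] V)) (x₀ : V) : ℕ → ℝ → V
  | 0 => fun _ => x₀
  | n + 1 => fun t => ∫ s in (0 : ℝ)..t, L s (seriesTerm L x₀ n s)

theorem continuous_seriesTerm [CompleteSpace V] (L : C(ℝ, V →L[ℝ] V)) (x₀ : V) (n : ℕ) :
    Continuous (seriesTerm L x₀ n) := by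
  induction n with
  | zero => exact continuous_const
  | succ n ih =>
    have hc : Continuous fun s => L s (seriesTerm L x₀ n s) := L.continuous.clm_apply ih
    exact continuous_iff_continuousAt.2 fun t =>
      (hc.integral_hasStrictDerivAt 0 t).hasDerivAt.continuousAt

theorem hasDerivAt_seriesTerm [CompleteSpace V] (L : C(ℝ, V →L[ℝ] V)) (x₀ : V) (n : ℕ) (t : ℝ) :
    HasDerivAt (seriesTerm L x₀ (n + 1)) (L t (seriesTerm L x₀ n t)) t := by
  have hc : Continuous fun s => L s (seriesTerm L x₀ n s) :=
    L.continuous.clm_apply (continuous_seriesTerm L x₀ n)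
  exact (hc.integral_hasStrictDerivAt 0 t).hasDerivAt

theorem norm_seriesTerm_le (L : C(ℝ, V →L[ℝ] V)) (x₀ : V) {T M : ℝ} (hM : 0 ≤ M)
    (hL : ∀ t, |t| ≤ T → ‖L t‖ ≤ M) (n : ℕ) (t : ℝ) (ht : |t| ≤ T) :
    ‖seriesTerm L x₀ n t‖ ≤ ‖x₀‖ * ((M * |t|) ^ n / (n.factorial : ℝ)) := by
  induction n generalizing t with
  | zero => simp [seriesTerm]
  | succ n ih =>
    set c : ℝ := ‖x₀‖ * M ^ (n + 1) / (n.factorial : ℝ) with hc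
    have hb : ∀ s, |s| ≤ T → ‖L s (seriesTerm L x₀ n s)‖ ≤ c * |s| ^ n := by
      intro s hs
      calc ‖L s (seriesTerm L x₀ n s)‖ ≤ ‖L s‖ * ‖seriesTerm L x₀ n s‖ := (L s).le_opNorm _
        _ ≤ M * (‖x₀‖ * ((M * |s|) ^ n / (n.factorial : ℝ))) :=
            mul_le_mul (hL s hs) (ih s hs) (norm_nonneg _) hM
        _ = c * |s| ^ n := by rw [hc]; ring
    have hfin : c * (|t| ^ (n + 1) / ((n : ℝ) + 1)) =
        ‖x₀‖ * ((M * |t|) ^ (n + 1) / ((n + 1).factorial : ℝ)) := by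
      rw [hc, Nat.factorial_succ]; push_cast
      have h1 : (n.factorial : ℝ) ≠ 0 := by positivity
      have h2 : (n : ℝ) + 1 ≠ 0 := by positivity
      rw [mul_pow]
      field_simp
    rw [← hfin]
    change ‖∫ s in (0 : ℝ)..t, L s (seriesTerm L x₀ n s)‖ ≤ _
    rcases le_total 0 t with h0 | h0
    · have hle : ‖∫ s in (0 : ℝ)..t, L s (seriesTerm L x₀ n s)‖ ≤ ∫ s in (0 : ℝ)..t, c * s ^ n := by
        refine intervalIntegral.norm_integral_le_of_norm_le h0 ?_
          (Continuous.intervalIntegrable (by fun_prop) _ _)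
        refine Filter.Eventually.of_forall fun s hs => ?_
        have hs0 : 0 ≤ s := hs.1.le
        have := hb s (by rw [abs_of_nonneg hs0]; rw [abs_of_nonneg h0] at ht; linarith [hs.2])
        rwa [abs_of_nonneg hs0] at this
      refine hle.trans (le_of_eq ?_)
      rw [intervalIntegral.integral_const_mul, integral_pow, abs_of_nonneg h0]
      simp
    · have hle : ‖∫ s in t..(0 : ℝ), L s (seriesTerm L x₀ n s)‖ ≤
          ∫ s in t..(0 : ℝ), c * (-s) ^ n := by
        refine intervalIntegral.norm_integral_le_of_norm_le h0 ?_
          (Continuous.intervalIntegrable (by fun_prop) _ _)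
        refine Filter.Eventually.of_forall fun s hs => ?_
        have hs0 : s ≤ 0 := hs.2
        have := hb s (by rw [abs_of_nonpos hs0]; rw [abs_of_nonpos h0] at ht; linarith [hs.1])
        rwa [abs_of_nonpos hs0] at this
      rw [intervalIntegral.integral_symm, norm_neg]
      refine hle.trans (le_of_eq ?_)
      rw [intervalIntegral.integral_const_mul,
        intervalIntegral.integral_comp_neg (fun s => s ^ n), integral_pow, abs_of_nonpos h0]
      simp

/-- A linear equation with continuous bounded-operator coefficient has a global solution. -/
theorem exists_linear_solution [CompleteSpace V] (L : C(ℝ, V →L[ℝ] V)) (x₀ : V) :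
    ∃ x : ℝ → V, x 0 = x₀ ∧ ∀ t, HasDerivAt x (L t (x t)) t := by
  have key : ∀ T : ℝ, 0 ≤ T → ∃ M : ℝ, 0 ≤ M ∧ ∀ t, |t| ≤ T → ‖L t‖ ≤ M := by
    intro T hT
    obtain ⟨M, hM⟩ := (isCompact_Icc (a := -T) (b := T)).exists_bound_of_continuousOn
      L.continuous.continuousOn
    exact ⟨M, (norm_nonneg _).trans (hM 0 ⟨by linarith, hT⟩), fun t ht => hM t (abs_le.1 ht)⟩
  have hsum : ∀ t, Summable fun n => seriesTerm L x₀ n t := by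
    intro t
    obtain ⟨M, hM0, hM⟩ := key |t| (abs_nonneg t)
    exact Summable.of_norm_bounded ((Real.summable_pow_div_factorial (M * |t|)).mul_left ‖x₀‖)
      fun n => norm_seriesTerm_le L x₀ hM0 hM n t le_rfl
  refine ⟨fun t => ∑' n, seriesTerm L x₀ n t, ?_, fun t => ?_⟩
  · change ∑' n, seriesTerm L x₀ n 0 = x₀
    rw [tsum_eq_single 0]
    · rfl
    · intro n hn
      obtain ⟨m, rfl⟩ := Nat.exists_eq_succ_of_ne_zero hn
      simp [seriesTerm]
  · set T : ℝ := |t| + 1 with hT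
    have hT0 : 0 ≤ T := by positivity
    obtain ⟨M, hM0, hM⟩ := key T hT0
    have hmem : ∀ {s : ℝ}, s ∈ Set.Ioo (-T) T → |s| ≤ T := fun hs => abs_le.2 ⟨hs.1.le, hs.2.le⟩
    have ht : t ∈ Set.Ioo (-T) T := abs_lt.1 (by rw [hT]; linarith)
    have hd : HasDerivAt (fun z => ∑' n, seriesTerm L x₀ (n + 1) z)
        (∑' n, L t (seriesTerm L x₀ n t)) t := by
      refine hasDerivAt_tsum_of_isPreconnected
        (u := fun n => M * (‖x₀‖ * ((M * T) ^ n / (n.factorial : ℝ))))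
        (((Real.summable_pow_div_factorial (M * T)).mul_left ‖x₀‖).mul_left M)
        isOpen_Ioo isPreconnected_Ioo (g := fun n => seriesTerm L x₀ (n + 1))
        (g' := fun n s => L s (seriesTerm L x₀ n s))
        (fun n s _ => hasDerivAt_seriesTerm L x₀ n s) (fun n s hs => ?_) ht
        ((summable_nat_add_iff 1).2 (hsum t)) ht
      have hs' := hmem hs
      calc ‖L s (seriesTerm L x₀ n s)‖ ≤ ‖L s‖ * ‖seriesTerm L x₀ n s‖ := (L s).le_opNorm _
        _ ≤ M * (‖x₀‖ * ((M * |s|) ^ n / (n.factorial : ℝ))) :=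
            mul_le_mul (hM s hs') (norm_seriesTerm_le L x₀ hM0 hM n s hs') (norm_nonneg _) hM0
        _ ≤ M * (‖x₀‖ * ((M * T) ^ n / (n.factorial : ℝ))) := by gcongr
    have hfun : (fun z => ∑' n, seriesTerm L x₀ n z) =
        fun z => x₀ + ∑' n, seriesTerm L x₀ (n + 1) z := by
      funext z
      rw [(hsum z).tsum_eq_zero_add]; rfl
    rw [hfun]
    have hval : L t (x₀ + ∑' n, seriesTerm L x₀ (n + 1) t) = ∑' n, L t (seriesTerm L x₀ n t) := by
      rw [← (L t).map_tsum (hsum t), (hsum t).tsum_eq_zero_add]; rfl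
    change HasDerivAt _ (L t (x₀ + ∑' n, seriesTerm L x₀ (n + 1) t)) t
    rw [hval]
    exact hd.const_add x₀

/-- Solutions of the initial value problem for a linear equation are unique. -/
theorem linear_solution_unique (L : C(ℝ, V →L[ℝ] V)) {x y : ℝ → V}
    (hx : ∀ t, HasDerivAt x (L t (x t)) t) (hy : ∀ t, HasDerivAt y (L t (y t)) t)
    (h0 : x 0 = y 0) : x = y := by
  funext t
  set T : ℝ := |t| + 1 with hT
  obtain ⟨M, hM⟩ := (isCompact_Icc (a := -T) (b := T)).exists_bound_of_continuousOn
    L.continuous.continuousOn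
  have hm : t ∈ Set.Ioo (-T) T := abs_lt.1 (by rw [hT]; linarith)
  have hm0 : (0 : ℝ) ∈ Set.Ioo (-T) T := by
    constructor <;> have := abs_nonneg t <;> linarith
  refine ODE_solution_unique_of_mem_Ioo (v := fun s z => L s z) (s := fun _ => Set.univ)
    (K := M.toNNReal) (fun s hs => ?_) hm0 (fun s _ => ⟨hx s, trivial⟩)
    (fun s _ => ⟨hy s, trivial⟩) h0 hm
  refine ((L s).lipschitz.weaken ?_).lipschitzOnWith
  rw [← NNReal.coe_le_coe, coe_nnnorm]
  exact (hM s (Set.Ioo_subset_Icc_self hs)).trans (Real.le_coe_toNNReal M)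

end LinearODE

/-! ### The Cauchy operator, exponential trichotomy, the Green function -/

section Equation

variable {𝕜 E : Type*} [RCLike 𝕜] [NormedAddCommGroup E] [NormedSpace ℝ E] [NormedSpace 𝕜 E]
  [IsScalarTower ℝ 𝕜 E]

/-- `U` solves the operator initial value problem `U' = A(t) U`, `U(0) = Id`. -/
def IsCauchyOperator (A : C(ℝ, E →L[𝕜] E)) (U : ℝ → E →L[𝕜] E) : Prop :=
  U 0 = ContinuousLinearMap.id 𝕜 E ∧ ∀ t, HasDerivAt U ((A t).comp (U t)) t

theorem existsUnique_isCauchyOperator [CompleteSpace E] (A : C(ℝ, E →L[𝕜] E)) :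
    ∃! U : ℝ → E →L[𝕜] E, IsCauchyOperator A U := by
  let L : C(ℝ, (E →L[𝕜] E) →L[ℝ] (E →L[𝕜] E)) :=
    ⟨fun t => (ContinuousLinearMap.compL 𝕜 E E E (A t)).restrictScalars ℝ, by
      exact (ContinuousLinearMap.restrictScalarsL 𝕜 (E →L[𝕜] E) (E →L[𝕜] E) ℝ ℝ).continuous.comp
        ((ContinuousLinearMap.compL 𝕜 E E E).continuous.comp A.continuous)⟩
  obtain ⟨U, hU0, hU⟩ := exists_linear_solution L (ContinuousLinearMap.id 𝕜 E)
  exact ⟨U, ⟨hU0, hU⟩, fun V hV => linear_solution_unique L hV.2 hU (hV.1.trans hU0.symm)⟩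

/-- The Cauchy operator `U(t, A)` of the equation `x' = A(t) x`. -/
def cauchyOp [CompleteSpace E] (A : C(ℝ, E →L[𝕜] E)) : ℝ → E →L[𝕜] E :=
  (existsUnique_isCauchyOperator A).choose

theorem cauchyOp_spec [CompleteSpace E] (A : C(ℝ, E →L[𝕜] E)) :
    IsCauchyOperator A (cauchyOp A) :=
  (existsUnique_isCauchyOperator A).choose_spec.1

/-- Every Cauchy operator is invertible. -/
theorem isUnit_cauchyOp [CompleteSpace E] (A : C(ℝ, E →L[𝕜] E)) (t : ℝ) :
    IsUnit (cauchyOp A t) := by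
  obtain ⟨hU0, hU⟩ := cauchyOp_spec A
  set U := cauchyOp A
  let B : (E →L[𝕜] E) →L[ℝ] (E →L[𝕜] E) →L[ℝ] (E →L[𝕜] E) :=
    (ContinuousLinearMap.compL 𝕜 E E E).bilinearRestrictScalars ℝ
  have hB : ∀ S T : E →L[𝕜] E, B S T = S * T := fun _ _ => rfl
  have hprod : ∀ {X Y : ℝ → E →L[𝕜] E} {X' Y' : E →L[𝕜] E} {s : ℝ}, HasDerivAt X X' s →
      HasDerivAt Y Y' s → HasDerivAt (fun s => X s * Y s) (X s * Y' + X' * Y s) s := by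
    intro X Y X' Y' s hX hY
    have := (B.hasFDerivAt_of_bilinear hX.hasFDerivAt hY.hasFDerivAt).hasDerivAt
    simpa [hB] using this
  let Lr : C(ℝ, (E →L[𝕜] E) →L[ℝ] (E →L[𝕜] E)) :=
    ⟨fun s => -(B.flip (A s)), (B.flip.continuous.comp A.continuous).neg⟩
  obtain ⟨Y, hY0, hY⟩ := exists_linear_solution Lr (1 : E →L[𝕜] E)
  have hLr : ∀ s T, Lr s T = -(T * A s) := fun _ _ => rfl
  have hUm : ∀ s, HasDerivAt U (A s * U s) s := hU
  have hYm : ∀ s, HasDerivAt Y (-(Y s * A s)) s := fun s => hLr s (Y s) ▸ hY s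
  have h1 : ∀ s, Y s * U s = 1 := by
    have hc : (fun s => Y s * U s) = fun _ => (1 : E →L[𝕜] E) := by
      refine linear_solution_unique (0 : C(ℝ, (E →L[𝕜] E) →L[ℝ] (E →L[𝕜] E))) (fun s => ?_)
        (fun s => by simpa using hasDerivAt_const s (1 : E →L[𝕜] E)) ?_
      · have := hprod (hYm s) (hUm s)
        simpa [mul_assoc] using this
      · rw [hY0, hU0]; rfl
    exact fun s => congrFun hc s
  have h2 : ∀ s, U s * Y s = 1 := by
    let Lc : C(ℝ, (E →L[𝕜] E) →L[ℝ] (E →L[𝕜] E)) :=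
      ⟨fun s => B (A s) - B.flip (A s),
        (B.continuous.comp A.continuous).sub (B.flip.continuous.comp A.continuous)⟩
    have hLc : ∀ s T, Lc s T = A s * T - T * A s := fun _ _ => rfl
    have hc : (fun s => U s * Y s) = fun _ => (1 : E →L[𝕜] E) := by
      refine linear_solution_unique Lc (fun s => ?_)
        (fun s => by simpa [hLc] using hasDerivAt_const s (1 : E →L[𝕜] E)) ?_
      · have := hprod (hUm s) (hYm s)
        rw [hLc]
        have he : A s * (U s * Y s) - U s * Y s * A s =
            U s * -(Y s * A s) + A s * U s * Y s := by
          rw [mul_neg, mul_assoc, mul_assoc, sub_eq_neg_add]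
        rw [he]
        exact this
      · rw [hY0, hU0]; rfl
    exact fun s => congrFun hc s
  exact ⟨⟨U t, Y t, h2 t, h1 t⟩, rfl⟩

/-- The operator `U(t, A) S U⁻¹(τ, A)`. -/
def transport [CompleteSpace E] (A : C(ℝ, E →L[𝕜] E)) (S : E →L[𝕜] E) (t τ : ℝ) : E →L[𝕜] E :=
  cauchyOp A t * S * Ring.inverse (cauchyOp A τ)

/-- The equation `x' = A(t) x` has an exponential trichotomy on `ℝ` with the projections `P`, `Q`
and the constants `N`, `ν`. -/
structure ExpTrichotomy [CompleteSpace E] (A : C(ℝ, E →L[𝕜] E)) (P Q : E →L[𝕜] E)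
    (N ν : ℝ) : Prop where
  proj_P : P * P = P
  proj_Q : Q * Q = Q
  comm : P * Q = Q * P
  sum : P + Q - P * Q = 1
  one_le : 1 ≤ N
  pos : 0 < ν
  bound_P : ∀ t τ, 0 ≤ τ → τ ≤ t → ‖transport A P t τ‖ ≤ N * Real.exp (-ν * (t - τ))
  bound_P' : ∀ t τ, t ≤ τ → 0 ≤ τ → ‖transport A (1 - P) t τ‖ ≤ N * Real.exp (-ν * (τ - t))
  bound_Q : ∀ t τ, t ≤ τ → τ ≤ 0 → ‖transport A Q t τ‖ ≤ N * Real.exp (-ν * (τ - t))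
  bound_Q' : ∀ t τ, τ ≤ t → τ ≤ 0 → ‖transport A (1 - Q) t τ‖ ≤ N * Real.exp (-ν * (t - τ))

/-- Condition (C): the family of projectors `U(t, A) P U⁻¹(t, A)`, `t ∈ ℝ`, is precompact in the
operator norm. -/
def ConditionC [CompleteSpace E] (A : C(ℝ, E →L[𝕜] E)) (P : E →L[𝕜] E) : Prop :=
  IsCompact (closure (Set.range fun t : ℝ => transport A P t t))

open Classical in
/-- The Green function of an equation with an exponential trichotomy. The value chosen on the null
set `τ = 0` or `τ = t` does not affect the integrals below. -/
def green [CompleteSpace E] (A : C(ℝ, E →L[𝕜] E)) (P Q : E →L[𝕜] E) (t τ : ℝ) : E →L[𝕜] E :=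
  if 0 ≤ τ then
    if τ < t then transport A P t τ else -transport A (1 - P) t τ
  else
    if t ≤ τ then -transport A Q t τ else transport A (1 - Q) t τ

/-- `φ` is a solution on `ℝ` of `u' = A(t) u + f(t) + F(t, u)`. -/
def IsSolution (A : C(ℝ, E →L[𝕜] E)) (f : C(ℝ, E)) (F : C(ℝ × E, E)) (φ : C(ℝ, E)) : Prop :=
  ∀ t : ℝ, HasDerivAt φ (A t (φ t) + f t + F (t, φ t)) t

/-- `φ` satisfies `φ(t) = ∫ G_A(t, τ) (f(τ) + F(τ, φ(τ))) dτ` over `ℝ` for every `t`, the integral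
being absolutely convergent. -/
def IsGreenSolution [CompleteSpace E] (A : C(ℝ, E →L[𝕜] E)) (P Q : E →L[𝕜] E) (f : C(ℝ, E))
    (F : C(ℝ × E, E)) (φ : C(ℝ, E)) : Prop :=
  ∀ t : ℝ, MeasureTheory.Integrable (fun τ : ℝ => green A P Q t τ (f τ + F (τ, φ τ))) ∧
    φ t = ∫ τ : ℝ, green A P Q t τ (f τ + F (τ, φ τ))

/-- `φ` is remotely compatible: every sequence `t n → ±∞` along which the shifts of `(A, f, F_Q)`
converge, where `Q` is the closure of `φ(ℝ)`, is one along which the shifts of `φ` converge. -/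
def RemotelyCompatible (A : C(ℝ, E →L[𝕜] E)) (f : C(ℝ, E)) (F : C(ℝ × E, E)) (φ : C(ℝ, E)) :
    Prop :=
  limitSeqs shiftTriple (A, f, restrictTo (closure (Set.range φ)) F) ⊆ limitSeqs shift φ

end Equation

end RemoteCompat

end

noncomputable section

namespace RemoteCompat

/-! ### Transported projections and the local estimate for bounded solutions -/

section Transport

variable {𝕜 E : Type*} [RCLike 𝕜] [NormedAddCommGroup E] [NormedSpace ℝ E] [NormedSpace 𝕜 E]
  [IsScalarTower ℝ 𝕜 E]

/-! The Green kernel is bounded by `N * exp (-ν * |t - τ|)`, whose integral is `2 * N / ν`. Hence `φ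
↦ ∫ G(t, τ) (f + F(·, φ)) dτ` contracts the bounded continuous functions with ratio `2 * N * L / ν <
1`, which gives existence and uniqueness.

Lagrange stability and remote compatibility both rest on a local estimate, `ExpTrichotomy.norm_le`.
If `T ≤ |r|`, the interval of radius `T` about `r` lies in one half-line, where the trichotomy is a
dichotomy. So a bounded solution of `w' = A w + h` is controlled at `r` by `h` on that interval
alone, up to an error of order `exp (-ν * T)`.

Apply this to `w = ψ - ψ(· + a)` with `a` the difference of two large shifts. It satisfies the same
equation with forcing `(A - A(· + a)) ψ(· + a) + g - g(· + a)`, which is small, apart from a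
feedback term of ratio `L`, once the shifts of the data are close. An asymptotic bound `δ` on the
distance between shifts of `ψ` then improves to `q * δ` with `q < 1`, and iteration makes these
shifts Cauchy (`ExpTrichotomy.locallyCauchyAlong`).

With zero feedback this shows that every Picard iterate is Lagrange stable, hence so is their
uniform limit; with feedback `L` it gives remote compatibility. -/

theorem hasDerivAt_operator_apply {X : ℝ → E →L[𝕜] E} {X' : E →L[𝕜] E} {w : ℝ → E} {w' : E} {s : ℝ}
    (hX : HasDerivAt X X' s) (hw : HasDerivAt w w' s) :
    HasDerivAt (fun s => X s (w s)) (X' (w s) + X s w') s := by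
  let B : (E →L[𝕜] E) →L[ℝ] E →L[ℝ] E :=
    (ContinuousLinearMap.id 𝕜 (E →L[𝕜] E)).bilinearRestrictScalars ℝ
  have hB : ∀ S x, B S x = S x := fun _ _ => rfl
  have := (B.hasFDerivAt_of_bilinear hX.hasFDerivAt hw.hasFDerivAt).hasDerivAt
  simpa [hB, add_comm] using this

variable [CompleteSpace E]

/-- Inversion has derivative `X ↦ -U⁻¹ X U⁻¹` at the unit `U`; with `X = A U` the factor `U U⁻¹`
cancels. -/
theorem hasDerivAt_inverse_cauchyOp (A : C(ℝ, E →L[𝕜] E)) (s : ℝ) :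
    HasDerivAt (fun s => Ring.inverse (cauchyOp A s)) (-(Ring.inverse (cauchyOp A s) * A s)) s := by
  obtain ⟨u, hu⟩ := isUnit_cauchyOp A s
  have h1 := (hasFDerivAt_ringInverse (𝕜 := 𝕜) u).restrictScalars ℝ
  rw [hu] at h1
  have h2 := h1.comp_hasDerivAt s ((cauchyOp_spec A).2 s)
  refine HasDerivAt.congr_deriv (f := fun s => Ring.inverse (cauchyOp A s)) h2 ?_
  change -((↑u⁻¹ : E →L[𝕜] E) * (A s * cauchyOp A s) * ↑u⁻¹) = _
  rw [← hu, Ring.inverse_unit, mul_assoc, mul_assoc, Units.mul_inv, mul_one]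

theorem continuous_inverse_cauchyOp (A : C(ℝ, E →L[𝕜] E)) :
    Continuous fun s => Ring.inverse (cauchyOp A s) :=
  continuous_iff_continuousAt.2 fun t => (hasDerivAt_inverse_cauchyOp A t).continuousAt

theorem continuous_transport (A : C(ℝ, E →L[𝕜] E)) (S : E →L[𝕜] E) (t : ℝ) :
    Continuous fun τ => transport A S t τ :=
  continuous_const.mul (continuous_inverse_cauchyOp A)

theorem cauchyOp_mul_inverse (A : C(ℝ, E →L[𝕜] E)) (t : ℝ) :
    cauchyOp A t * Ring.inverse (cauchyOp A t) = 1 :=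
  Ring.mul_inverse_cancel _ (isUnit_cauchyOp A t)

theorem transport_add (A : C(ℝ, E →L[𝕜] E)) (S S' : E →L[𝕜] E) (t τ : ℝ) :
    transport A (S + S') t τ = transport A S t τ + transport A S' t τ := by
  simp only [transport, mul_add, add_mul]

/-- Variation of constants for the transported component of a solution. -/
theorem hasDerivAt_transport_apply (A : C(ℝ, E →L[𝕜] E)) (S : E →L[𝕜] E) (r : ℝ) {w : ℝ → E}
    {h : E} {s : ℝ} (hw : HasDerivAt w (A s (w s) + h) s) :
    HasDerivAt (fun s => transport A S r s (w s)) (transport A S r s h) s := by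
  have h1 := hasDerivAt_operator_apply (hasDerivAt_inverse_cauchyOp A s) hw
  have h2 := hasDerivAt_operator_apply (hasDerivAt_const s (cauchyOp A r * S)) h1
  -- The term `-U⁻¹ A w` from differentiating `U⁻¹` cancels the homogeneous part of `w'`.
  refine h2.congr_deriv ?_
  simp [transport, mul_assoc]

/-- The integral of an exponential kernel is at most `1 / ν`. -/
theorem integral_exp_kernel_le {ν T r : ℝ} (hν : 0 < ν) :
    ∫ s in (r - T)..r, Real.exp (-ν * (r - s)) ≤ 1 / ν := by
  have hd : ∀ s ∈ Set.uIcc (r - T) r,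
      HasDerivAt (fun s => Real.exp (-ν * (r - s)) / ν) (Real.exp (-ν * (r - s))) s := by
    intro s _
    have h1 : HasDerivAt (fun s => -ν * (r - s)) (-ν * (-1)) s :=
      ((hasDerivAt_id s).const_sub r).const_mul (-ν)
    refine (h1.exp.div_const ν).congr_deriv ?_
    field_simp
  rw [intervalIntegral.integral_eq_sub_of_hasDerivAt hd
    (Continuous.intervalIntegrable (by fun_prop) _ _)]
  have : 0 ≤ Real.exp (-ν * (r - (r - T))) / ν := by positivity
  simp only [sub_self, mul_zero, Real.exp_zero]
  linarith

theorem integral_exp_kernel_le' {ν T r : ℝ} (hν : 0 < ν) :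
    ∫ s in r..(r + T), Real.exp (-ν * (s - r)) ≤ 1 / ν := by
  have hd : ∀ s ∈ Set.uIcc r (r + T),
      HasDerivAt (fun s => -(Real.exp (-ν * (s - r)) / ν)) (Real.exp (-ν * (s - r))) s := by
    intro s _
    have h1 : HasDerivAt (fun s => -ν * (s - r)) (-ν * 1) s :=
      ((hasDerivAt_id s).sub_const r).const_mul (-ν)
    refine (h1.exp.div_const ν).neg.congr_deriv ?_
    field_simp
  rw [intervalIntegral.integral_eq_sub_of_hasDerivAt hd
    (Continuous.intervalIntegrable (by fun_prop) _ _)]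
  have : 0 ≤ Real.exp (-ν * (r + T - r)) / ν := by positivity
  simp only [sub_self, mul_zero, Real.exp_zero]
  linarith

/-- Estimate of a solution at the centre of an interval on which the equation has a dichotomy. -/
theorem norm_le_of_dichotomy (A : C(ℝ, E →L[𝕜] E)) (S : E →L[𝕜] E) {N ν T r M δ : ℝ}
    (hν : 0 < ν) (hN : 0 ≤ N) (hT : 0 ≤ T)
    (h1 : ∀ s, r - T ≤ s → s ≤ r → ‖transport A S r s‖ ≤ N * Real.exp (-ν * (r - s)))
    (h2 : ∀ s, r ≤ s → s ≤ r + T → ‖transport A (1 - S) r s‖ ≤ N * Real.exp (-ν * (s - r)))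
    {w h : ℝ → E} (hw : ∀ s, HasDerivAt w (A s (w s) + h s) s) (hh : Continuous h)
    (hM : ∀ s, ‖w s‖ ≤ M) (hδ : ∀ s, |s - r| ≤ T → ‖h s‖ ≤ δ) :
    ‖w r‖ ≤ 2 * N * Real.exp (-ν * T) * M + 2 * N / ν * δ := by
  have hδ0 : 0 ≤ δ := (norm_nonneg _).trans (hδ r (by simpa))
  have hci : ∀ S' : E →L[𝕜] E, Continuous fun s => transport A S' r s (h s) := fun S' =>
    (continuous_transport A S' r).clm_apply hh
  have e1 := intervalIntegral.integral_eq_sub_of_hasDerivAt (a := r - T) (b := r)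
    (fun s _ => hasDerivAt_transport_apply A S r (hw s)) ((hci S).intervalIntegrable _ _)
  have e2 := intervalIntegral.integral_eq_sub_of_hasDerivAt (a := r) (b := r + T)
    (fun s _ => hasDerivAt_transport_apply A (1 - S) r (hw s)) ((hci (1 - S)).intervalIntegrable _ _)
  have hsum : w r = transport A S r r (w r) + transport A (1 - S) r r (w r) := by
    rw [← add_apply, ← transport_add, add_sub_cancel, transport, mul_one,
      cauchyOp_mul_inverse]
    rfl
  -- The `S`-component is carried forward from `r - T` and the complementary one backward from `r +
  -- T`, so every kernel decays in the direction in which it is used.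
  have hrep : w r = transport A S r (r - T) (w (r - T))
      + (∫ s in (r - T)..r, transport A S r s (h s))
      + (transport A (1 - S) r (r + T) (w (r + T))
      - ∫ s in r..(r + T), transport A (1 - S) r s (h s)) := by
    rw [e1, e2]
    conv_lhs => rw [hsum]
    abel
  have b1 : ‖transport A S r (r - T) (w (r - T))‖ ≤ N * Real.exp (-ν * T) * M := by
    have := h1 (r - T) le_rfl (by linarith)
    rw [sub_sub_cancel] at this
    exact (ContinuousLinearMap.le_opNorm _ _).trans
      (mul_le_mul this (hM _) (norm_nonneg _) (by positivity))
  have b2 : ‖transport A (1 - S) r (r + T) (w (r + T))‖ ≤ N * Real.exp (-ν * T) * M := by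
    have := h2 (r + T) (by linarith) le_rfl
    rw [add_sub_cancel_left] at this
    exact (ContinuousLinearMap.le_opNorm _ _).trans
      (mul_le_mul this (hM _) (norm_nonneg _) (by positivity))
  have b3 : ‖∫ s in (r - T)..r, transport A S r s (h s)‖ ≤ N * δ * (1 / ν) := by
    have : ‖∫ s in (r - T)..r, transport A S r s (h s)‖ ≤
        ∫ s in (r - T)..r, N * δ * Real.exp (-ν * (r - s)) := by
      refine intervalIntegral.norm_integral_le_of_norm_le (by linarith)
        (Eventually.of_forall fun s hs => ?_) (Continuous.intervalIntegrable (by fun_prop) _ _)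
      calc _ ≤ _ := ContinuousLinearMap.le_opNorm _ _
        _ ≤ N * Real.exp (-ν * (r - s)) * δ :=
          mul_le_mul (h1 s hs.1.le hs.2) (hδ s (abs_le.2 ⟨by linarith [hs.1], by linarith [hs.2]⟩))
            (norm_nonneg _) (by positivity)
        _ = _ := by ring
    refine this.trans ?_
    rw [intervalIntegral.integral_const_mul]
    exact mul_le_mul_of_nonneg_left (integral_exp_kernel_le hν) (by positivity)
  have b4 : ‖∫ s in r..(r + T), transport A (1 - S) r s (h s)‖ ≤ N * δ * (1 / ν) := by
    have : ‖∫ s in r..(r + T), transport A (1 - S) r s (h s)‖ ≤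
        ∫ s in r..(r + T), N * δ * Real.exp (-ν * (s - r)) := by
      refine intervalIntegral.norm_integral_le_of_norm_le (by linarith)
        (Eventually.of_forall fun s hs => ?_) (Continuous.intervalIntegrable (by fun_prop) _ _)
      calc _ ≤ _ := ContinuousLinearMap.le_opNorm _ _
        _ ≤ N * Real.exp (-ν * (s - r)) * δ :=
          mul_le_mul (h2 s hs.1.le hs.2) (hδ s (abs_le.2 ⟨by linarith [hs.1], by linarith [hs.2]⟩))
            (norm_nonneg _) (by positivity)
        _ = _ := by ring
    refine this.trans ?_
    rw [intervalIntegral.integral_const_mul]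
    exact mul_le_mul_of_nonneg_left (integral_exp_kernel_le' hν) (by positivity)
  rw [hrep]
  calc _ ≤ _ := norm_add_le _ _
    _ ≤ _ := add_le_add (norm_add_le _ _) (norm_sub_le _ _)
    _ ≤ _ := add_le_add (add_le_add b1 b3) (add_le_add b2 b4)
    _ = _ := by ring

/-- Away from the origin a trichotomy gives a dichotomy on long intervals, hence an estimate of
bounded solutions which is local in the right-hand side. -/
theorem ExpTrichotomy.norm_le {A : C(ℝ, E →L[𝕜] E)} {P Q : E →L[𝕜] E} {N ν : ℝ}
    (H : ExpTrichotomy A P Q N ν) {T r M δ : ℝ} (hT : 0 ≤ T) (hr : T ≤ |r|)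
    {w h : ℝ → E} (hw : ∀ s, HasDerivAt w (A s (w s) + h s) s) (hh : Continuous h)
    (hM : ∀ s, ‖w s‖ ≤ M) (hδ : ∀ s, |s - r| ≤ T → ‖h s‖ ≤ δ) :
    ‖w r‖ ≤ 2 * N * Real.exp (-ν * T) * M + 2 * N / ν * δ := by
  have hN : 0 ≤ N := zero_le_one.trans H.one_le
  -- For `T ≤ r` the window lies in `[0, ∞)` and `P` is the stable projection; for `r ≤ -T` it lies
  -- in `(-∞, 0]` and `1 - Q` plays that role.
  rcases le_abs.1 hr with hr | hr
  · exact norm_le_of_dichotomy A P H.pos hN hT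
      (fun s h1 h2 => H.bound_P r s (by linarith) h2)
      (fun s h1 h2 => H.bound_P' r s h1 (by linarith)) hw hh hM hδ
  · refine norm_le_of_dichotomy A (1 - Q) H.pos hN hT
      (fun s h1 h2 => H.bound_Q' r s h2 (by linarith))
      (fun s h1 h2 => ?_) hw hh hM hδ
    rw [sub_sub_cancel]
    exact H.bound_Q r s h1 (by linarith)

end Transport

/-! ### The Green function and its integral operator -/

section Green

variable {𝕜 E : Type*} [RCLike 𝕜] [NormedAddCommGroup E] [NormedSpace ℝ E] [NormedSpace 𝕜 E]
  [IsScalarTower ℝ 𝕜 E] [CompleteSpace E]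

theorem ExpTrichotomy.norm_green_le {A : C(ℝ, E →L[𝕜] E)} {P Q : E →L[𝕜] E} {N ν : ℝ}
    (H : ExpTrichotomy A P Q N ν) (t τ : ℝ) :
    ‖green A P Q t τ‖ ≤ N * Real.exp (-ν * |t - τ|) := by
  unfold green
  split_ifs with h1 h2 h2
  · rw [abs_of_nonneg (by linarith)]; exact H.bound_P t τ h1 h2.le
  · rw [norm_neg, abs_of_nonpos (by linarith), neg_sub]; exact H.bound_P' t τ (not_lt.1 h2) h1
  · rw [norm_neg, abs_of_nonpos (by linarith), neg_sub]; exact H.bound_Q t τ h2 (not_le.1 h1).le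
  · rw [abs_of_nonneg (by linarith)]; exact H.bound_Q' t τ (not_le.1 h2).le (not_le.1 h1).le

theorem stronglyMeasurable_green_apply (A : C(ℝ, E →L[𝕜] E)) (P Q : E →L[𝕜] E) (t : ℝ)
    {g : ℝ → E} (hg : Continuous g) :
    MeasureTheory.StronglyMeasurable fun τ => green A P Q t τ (g τ) := by
  have hc : ∀ S : E →L[𝕜] E,
      MeasureTheory.StronglyMeasurable fun τ => transport A S t τ (g τ) := fun S =>
    ((continuous_transport A S t).clm_apply hg).stronglyMeasurable
  have e : (fun τ => green A P Q t τ (g τ)) = fun τ => if τ ∈ Set.Ici (0 : ℝ) then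
      (if τ ∈ Set.Iio t then transport A P t τ (g τ) else -transport A (1 - P) t τ (g τ))
      else (if τ ∈ Set.Ici t then -transport A Q t τ (g τ) else transport A (1 - Q) t τ (g τ)) := by
    funext τ
    simp only [green, Set.mem_Ici, Set.mem_Iio]
    split_ifs <;> rfl
  rw [e]
  exact MeasureTheory.StronglyMeasurable.ite measurableSet_Ici
    (MeasureTheory.StronglyMeasurable.ite measurableSet_Iio (hc _) (hc _).neg)
    (MeasureTheory.StronglyMeasurable.ite measurableSet_Ici (hc _).neg (hc _))

theorem integrable_exp_kernel {ν : ℝ} (hν : 0 < ν) (t : ℝ) :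
    MeasureTheory.Integrable fun τ => Real.exp (-ν * |t - τ|) := by
  have h : MeasureTheory.Integrable fun τ => Real.exp (-ν * |τ|) := by
    rw [← MeasureTheory.integrableOn_univ, ← Set.Iic_union_Ioi (a := (0 : ℝ))]
    refine MeasureTheory.IntegrableOn.union ?_ ?_
    · refine (integrableOn_exp_mul_Iic hν 0).congr_fun (fun x hx => ?_) measurableSet_Iic
      simp only [abs_of_nonpos (Set.mem_Iic.1 hx), mul_neg, neg_mul, neg_neg]
    · refine (integrableOn_exp_mul_Ioi (neg_neg_of_pos hν) 0).congr_fun (fun x hx => ?_)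
        measurableSet_Ioi
      simp only [abs_of_pos (Set.mem_Ioi.1 hx)]
  exact h.comp_sub_left t

theorem integral_exp_kernel {ν : ℝ} (hν : 0 < ν) (t : ℝ) :
    ∫ τ, Real.exp (-ν * |t - τ|) = 2 / ν := by
  rw [MeasureTheory.integral_sub_left_eq_self (fun x => Real.exp (-ν * |x|)),
    integral_comp_abs (f := fun x => Real.exp (-ν * x)), integral_exp_mul_Ioi (neg_neg_of_pos hν)]
  simp
  field_simp

theorem ExpTrichotomy.integrable_green {A : C(ℝ, E →L[𝕜] E)} {P Q : E →L[𝕜] E} {N ν : ℝ}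
    (H : ExpTrichotomy A P Q N ν) {g : ℝ → E} (hg : Continuous g) {M : ℝ}
    (hM : ∀ τ, ‖g τ‖ ≤ M) (t : ℝ) :
    MeasureTheory.Integrable fun τ => green A P Q t τ (g τ) := by
  have hN : 0 ≤ N := zero_le_one.trans H.one_le
  refine (((integrable_exp_kernel H.pos t).const_mul N).mul_const M).mono'
    (stronglyMeasurable_green_apply A P Q t hg).aestronglyMeasurable
    (Eventually.of_forall fun τ => ?_)
  exact (ContinuousLinearMap.le_opNorm _ _).trans
    (mul_le_mul (H.norm_green_le t τ) (hM τ) (norm_nonneg _) (by positivity))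

theorem ExpTrichotomy.norm_integral_green_le {A : C(ℝ, E →L[𝕜] E)} {P Q : E →L[𝕜] E} {N ν : ℝ}
    (H : ExpTrichotomy A P Q N ν) {g : ℝ → E} {M : ℝ} (hM : ∀ τ, ‖g τ‖ ≤ M) (t : ℝ) :
    ‖∫ τ, green A P Q t τ (g τ)‖ ≤ 2 * N / ν * M := by
  have hN : 0 ≤ N := zero_le_one.trans H.one_le
  have := MeasureTheory.norm_integral_le_of_norm_le (f := fun τ => green A P Q t τ (g τ))
    (((integrable_exp_kernel H.pos t).const_mul N).mul_const M)
    (Eventually.of_forall fun τ => (ContinuousLinearMap.le_opNorm _ _).trans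
      (mul_le_mul (H.norm_green_le t τ) (hM τ) (norm_nonneg _) (by positivity)))
  refine this.trans (le_of_eq ?_)
  rw [MeasureTheory.integral_mul_const, MeasureTheory.integral_const_mul,
    integral_exp_kernel H.pos t]
  ring

/-- Off the two jumps, the Green function at `t` is obtained from the one at `0` by moving the
jump from `0` to `t`. -/
theorem green_apply_eq (A : C(ℝ, E →L[𝕜] E)) (P Q : E →L[𝕜] E) {t τ : ℝ} (h0 : τ ≠ 0) (ht : τ ≠ t)
    (g : ℝ → E) : green A P Q t τ (g τ) = cauchyOp A t (green A P Q 0 τ (g τ) +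
      ((Set.Ioc 0 t).indicator (fun τ => Ring.inverse (cauchyOp A τ) (g τ)) τ -
        (Set.Ioc t 0).indicator (fun τ => Ring.inverse (cauchyOp A τ) (g τ)) τ)) := by
  have hU0 : cauchyOp A 0 = 1 := (cauchyOp_spec A).1
  -- Across `τ = t` the middle factor jumps by `P + (1 - P) = 1` or `(1 - Q) + Q = 1`, so moving the
  -- jump costs exactly one copy of `U⁻¹(τ)`.
  rcases lt_or_gt_of_ne h0 with h0 | h0 <;> rcases lt_or_gt_of_ne ht with ht | ht <;>
  simp [green, transport, hU0, Set.indicator, h0, h0.le, h0.not_ge, ht, ht.le, ht.not_ge,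
    h0.not_gt, ht.not_gt]
  abel

/-- This confines the dependence on `t` to `U(t)` and the endpoint of an interval integral, so the
Green integral can be differentiated without passing a derivative under an improper integral. -/
theorem ExpTrichotomy.integral_green_eq {A : C(ℝ, E →L[𝕜] E)} {P Q : E →L[𝕜] E} {N ν : ℝ}
    (H : ExpTrichotomy A P Q N ν) {g : ℝ → E} (hg : Continuous g) {M : ℝ}
    (hM : ∀ τ, ‖g τ‖ ≤ M) (t : ℝ) :
    ∫ τ, green A P Q t τ (g τ) = cauchyOp A t ((∫ τ, green A P Q 0 τ (g τ)) +
      ∫ τ in (0 : ℝ)..t, Ring.inverse (cauchyOp A τ) (g τ)) := by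
  have hV : Continuous fun τ => Ring.inverse (cauchyOp A τ) (g τ) :=
    (continuous_inverse_cauchyOp A).clm_apply hg
  have hi : ∀ a b : ℝ, MeasureTheory.Integrable
      ((Set.Ioc a b).indicator fun τ => Ring.inverse (cauchyOp A τ) (g τ)) := fun a b =>
    (MeasureTheory.integrable_indicator_iff measurableSet_Ioc).2 (hV.integrableOn_Ioc)
  have hae : (fun τ => green A P Q t τ (g τ)) =ᵐ[MeasureTheory.volume] fun τ =>
      cauchyOp A t (green A P Q 0 τ (g τ) +
      ((Set.Ioc 0 t).indicator (fun τ => Ring.inverse (cauchyOp A τ) (g τ)) τ -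
        (Set.Ioc t 0).indicator (fun τ => Ring.inverse (cauchyOp A τ) (g τ)) τ)) := by
    filter_upwards [MeasureTheory.Measure.ae_ne MeasureTheory.volume (0 : ℝ),
      MeasureTheory.Measure.ae_ne MeasureTheory.volume t] with τ h0 ht
    exact green_apply_eq A P Q h0 ht g
  have h0 := H.integrable_green hg hM 0
  have hs := (hi 0 t).sub (hi t 0)
  rw [MeasureTheory.integral_congr_ae hae]
  refine ((cauchyOp A t).integral_comp_comm (h0.add hs)).trans (congrArg _ ?_)
  refine (MeasureTheory.integral_add h0 hs).trans (congrArg _ ?_)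
  refine (MeasureTheory.integral_sub (hi 0 t) (hi t 0)).trans ?_
  rw [MeasureTheory.integral_indicator measurableSet_Ioc,
    MeasureTheory.integral_indicator measurableSet_Ioc, intervalIntegral]

/-- The Green integral of a bounded continuous function solves the inhomogeneous equation. -/
theorem ExpTrichotomy.hasDerivAt_integral_green {A : C(ℝ, E →L[𝕜] E)} {P Q : E →L[𝕜] E} {N ν : ℝ}
    (H : ExpTrichotomy A P Q N ν) {g : ℝ → E} (hg : Continuous g) {M : ℝ}
    (hM : ∀ τ, ‖g τ‖ ≤ M) (t : ℝ) :
    HasDerivAt (fun t => ∫ τ, green A P Q t τ (g τ))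
      (A t (∫ τ, green A P Q t τ (g τ)) + g t) t := by
  have hV : Continuous fun τ => Ring.inverse (cauchyOp A τ) (g τ) :=
    (continuous_inverse_cauchyOp A).clm_apply hg
  have h1 := (hV.integral_hasStrictDerivAt 0 t).hasDerivAt.const_add
    (∫ τ, green A P Q 0 τ (g τ))
  have h2 := hasDerivAt_operator_apply ((cauchyOp_spec A).2 t) h1
  rw [funext fun t => H.integral_green_eq hg hM t]
  refine h2.congr_deriv ?_
  have e : cauchyOp A t (Ring.inverse (cauchyOp A t) (g t)) = g t :=
    DFunLike.congr_fun (cauchyOp_mul_inverse A t) (g t)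
  rw [e, H.integral_green_eq hg hM t]
  rfl

end Green

/-! ### Lagrange stability through ultrafilters -/

section Stability

variable {Z Y : Type*}

theorem LagrangeStable.exists_tendsto [TopologicalSpace Z] {π : ℝ → Z → Z} {z : Z}
    (h : LagrangeStable π z) {ι : Type*} (l : Ultrafilter ι) (t : ι → ℝ) :
    ∃ y, Tendsto (fun i => π (t i) z) l (𝓝 y) := by
  obtain ⟨y, -, hy⟩ := h.ultrafilter_le_nhds (l.map fun i : ι => π (t i) z)
    (tendsto_principal.2 (Eventually.of_forall fun i => subset_closure ⟨t i, rfl⟩))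
  exact ⟨y, hy⟩

theorem LagrangeStable.isCompact_closure_map [TopologicalSpace Z] [TopologicalSpace Y] [R1Space Y]
    {π : ℝ → Z → Z} {z : Z} (h : LagrangeStable π z) {Φ : Z → Y} (hΦ : Continuous Φ) :
    IsCompact (closure (Set.range fun t => Φ (π t z))) := by
  refine (h.image hΦ).closure_of_subset ?_
  rintro _ ⟨t, rfl⟩
  exact ⟨_, subset_closure ⟨t, rfl⟩, rfl⟩

theorem LagrangeStable.of_totallyBounded [UniformSpace Z] [CompleteSpace Z] {π : ℝ → Z → Z} {z : Z}
    (h : TotallyBounded (Set.range fun t => π t z)) : LagrangeStable π z :=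
  h.closure.isCompact_of_isClosed isClosed_closure

/-- Total boundedness means that every ultrafilter containing the trajectory is Cauchy. Choosing a
time for each point of the trajectory exhibits such an ultrafilter as its own image under `y ↦ π (t
y) z`. -/
theorem LagrangeStable.of_ultrafilter [UniformSpace Z] [CompleteSpace Z] {π : ℝ → Z → Z} {z : Z}
    (h : ∀ (l : Ultrafilter Z) (t : Z → ℝ), Cauchy (map (fun i => π (t i) z) l)) :
    LagrangeStable π z := by
  refine .of_totallyBounded (totallyBounded_iff_ultrafilter.2 fun l hl => ?_)
  have hl' : ∀ᶠ y in (l : Filter Z), y ∈ Set.range fun t => π t z := le_principal_iff.1 hl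
  choose! t ht using fun y (hy : y ∈ Set.range fun t => π t z) => hy
  have e : map (fun y => π (t y) z) (l : Filter Z) = l := by
    have : (fun y => π (t y) z) =ᶠ[l] id := by
      filter_upwards [hl'] with y hy using ht y hy
    rw [map_congr this, map_id]
  exact e ▸ h l t

/-- An ultrafilter decides, for each `R`, whether `|t| ≤ R`. If some `R` works, compactness of `[-R,
R]` gives a limit. -/
theorem ultrafilter_tendsto_or_abs_atTop {ι : Type*} (l : Ultrafilter ι) (t : ι → ℝ) :
    (∃ a, Tendsto t l (𝓝 a)) ∨ Tendsto (fun i => |t i|) l atTop := by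
  by_cases h : ∃ R, ∀ᶠ i in (l : Filter ι), |t i| ≤ R
  · obtain ⟨R, hR⟩ := h
    obtain ⟨a, -, ha⟩ := (isCompact_Icc (a := -R) (b := R)).ultrafilter_le_nhds (l.map t)
      (le_principal_iff.2 (hR.mono fun i hi => abs_le.1 hi))
    exact .inl ⟨a, ha⟩
  · push Not at h
    refine .inr (tendsto_atTop.2 fun R => ?_)
    exact (h R).mono fun i hi => hi.le

end Stability

/-! ### Shifts in the compact-open topology and locally uniform Cauchy families -/

section ShiftMaps

variable {X : Type*} [NormedAddCommGroup X]

theorem continuous_shift (φ : C(ℝ, X)) : Continuous fun h => shift h φ := by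
  let G : C(ℝ × ℝ, X) := φ.comp ⟨fun p => p.2 + p.1, by fun_prop⟩
  exact G.curry.continuous

theorem eventually_norm_sub_le_of_cauchy {Y ι : Type*} [TopologicalSpace Y] {u : ι → C(Y, X)}
    {l : Filter ι} (h : Cauchy (map u l)) {K : Set Y} (hK : IsCompact K) {ε : ℝ} (hε : 0 < ε) :
    ∀ᶠ p in l ×ˢ l, ∀ x ∈ K, ‖u p.1 x - u p.2 x‖ ≤ ε := by
  have h2 := (cauchy_map_iff.1 h).2
  have := h2.eventually (ContinuousMap.hasBasis_compactConvergenceUniformity.mem_of_mem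
    (i := (K, {p : X × X | dist p.1 p.2 < ε})) ⟨hK, Metric.dist_mem_uniformity hε⟩)
  filter_upwards [this] with p hp x hx
  rw [← dist_eq_norm]
  exact (hp x hx).le

/-- The shifts of `ψ` by `t i` are uniformly Cauchy on bounded intervals along `l`. -/
def LocallyCauchyAlong {ι : Type*} (l : Filter ι) (t : ι → ℝ) (ψ : ℝ → X) : Prop :=
  ∀ ρ ε : ℝ, 0 < ε → ∀ᶠ p in l ×ˢ l, ∀ s, |s| ≤ ρ → ‖ψ (s + t p.1) - ψ (s + t p.2)‖ ≤ ε

theorem LocallyCauchyAlong.of_cauchy {ι : Type*} {l : Filter ι} {t : ι → ℝ} {ψ : C(ℝ, X)}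
    (h : Cauchy (map (fun i => shift (t i) ψ) l)) : LocallyCauchyAlong l t ψ := by
  intro ρ ε hε
  filter_upwards [eventually_norm_sub_le_of_cauchy h (isCompact_Icc (a := -ρ) (b := ρ)) hε]
    with p hp s hs using hp s (abs_le.1 hs)

theorem LocallyCauchyAlong.cauchy {ι : Type*} {l : Filter ι} [l.NeBot] {t : ι → ℝ} {ψ : C(ℝ, X)}
    (h : LocallyCauchyAlong l t ψ) : Cauchy (map (fun i => shift (t i) ψ) l) := by
  refine cauchy_map_iff.2 ⟨‹_›, ?_⟩
  refine ContinuousMap.hasBasis_compactConvergenceUniformity.tendsto_right_iff.2 ?_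
  rintro ⟨K, V⟩ ⟨hK, hV⟩
  obtain ⟨ε, hε, hεV⟩ := Metric.mem_uniformity_dist.1 hV
  obtain ⟨ρ, hρ⟩ := hK.isBounded.exists_norm_le
  filter_upwards [h ρ (ε / 2) (by positivity)] with p hp x hx
  refine hεV ?_
  rw [dist_eq_norm]
  exact (hp x (hρ x hx)).trans_lt (by linarith)

/-- Lagrange stability can be tested along ultrafilters on which the shifts leave every compact
set. -/
theorem LagrangeStable.shift_of_locallyCauchyAlong [CompleteSpace X] {ψ : C(ℝ, X)}
    (h : ∀ (l : Ultrafilter C(ℝ, X)) (t : C(ℝ, X) → ℝ), Tendsto (fun i => |t i|) l atTop →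
      LocallyCauchyAlong (l : Filter C(ℝ, X)) t ψ) : LagrangeStable shift ψ := by
  refine .of_ultrafilter fun l t => ?_
  rcases ultrafilter_tendsto_or_abs_atTop l t with ⟨a, ha⟩ | ht
  · exact (((continuous_shift ψ).tendsto a).comp ha).cauchy_map
  · exact (h l t ht).cauchy

theorem LagrangeStable.isCompact_closure_range {φ : C(ℝ, X)} (h : LagrangeStable shift φ) :
    IsCompact (closure (Set.range φ)) := by
  have := h.isCompact_closure_map (Φ := fun g : C(ℝ, X) => g 0) (by fun_prop)
  simpa [shift, Function.comp_def] using this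

theorem LagrangeStable.exists_norm_le {φ : C(ℝ, X)} (h : LagrangeStable shift φ) :
    ∃ M, ∀ t, ‖φ t‖ ≤ M := by
  obtain ⟨M, hM⟩ := h.isCompact_closure_range.isBounded.exists_norm_le
  exact ⟨M, fun t => hM _ (subset_closure ⟨t, rfl⟩)⟩

theorem LagrangeStable.restrictTo {W : Type*} [TopologicalSpace W] {F : C(ℝ × W, X)}
    (h : LagrangeStable shiftTime F) (K : Set W) :
    LagrangeStable shiftTime (restrictTo K F) :=
  h.isCompact_closure_map (Φ := RemoteCompat.restrictTo K) (ContinuousMap.continuous_precomp _)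

/-- Lagrange stability is preserved under uniform limits. -/
theorem LagrangeStable.of_uniform_approx [CompleteSpace X] {φ : C(ℝ, X)}
    (h : ∀ ε > 0, ∃ ψ : C(ℝ, X), LagrangeStable shift ψ ∧ ∀ t, ‖φ t - ψ t‖ ≤ ε) :
    LagrangeStable shift φ := by
  refine .shift_of_locallyCauchyAlong fun l t _ ρ ε hε => ?_
  obtain ⟨ψ, hψ, hd⟩ := h (ε / 3) (by positivity)
  obtain ⟨y, hy⟩ := hψ.exists_tendsto l t
  filter_upwards [LocallyCauchyAlong.of_cauchy hy.cauchy_map ρ (ε / 3) (by positivity)]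
    with p hp s hs
  have e : φ (s + t p.1) - φ (s + t p.2) = (φ (s + t p.1) - ψ (s + t p.1)) +
      (ψ (s + t p.1) - ψ (s + t p.2)) - (φ (s + t p.2) - ψ (s + t p.2)) := by abel
  rw [e]
  calc _ ≤ _ := norm_sub_le _ _
    _ ≤ _ := add_le_add (norm_add_le _ _) le_rfl
    _ ≤ ε / 3 + ε / 3 + ε / 3 := add_le_add (add_le_add (hd _) (hp s hs)) (hd _)
    _ = ε := by ring

theorem lagrangeStable_shift_zero [CompleteSpace X] : LagrangeStable shift (0 : C(ℝ, X)) :=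
  .shift_of_locallyCauchyAlong fun _ _ _ _ _ hε => Eventually.of_forall fun _ _ _ => by
    simpa using hε.le

end ShiftMaps

/-! ### Asymptotic comparison of two shifts of a bounded solution -/

section Comparison

variable {E : Type*} [NormedAddCommGroup E]

/-- Comparison of the shifts of a superposition with the shifts of its inner function. -/
theorem eventually_norm_superposition_sub_le {f φ : C(ℝ, E)} {F : C(ℝ × E, E)} {L : NNReal}
    (hLip : ∀ t : ℝ, LipschitzWith L (fun u : E => F (t, u))) {K : Set E} (hK : IsCompact K)
    (hφ : ∀ t, φ t ∈ K) {ι : Type*} {l : Filter ι} {t : ι → ℝ}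
    (hf : LocallyCauchyAlong l t f)
    (hF : Cauchy (map (fun i => shiftTime (t i) (restrictTo K F)) l))
    (ρ η : ℝ) (hη : 0 < η) :
    ∀ᶠ p in l ×ˢ l, ∀ s, |s| ≤ ρ →
      ‖(f (s + t p.1) + F (s + t p.1, φ (s + t p.1))) -
        (f (s + t p.2) + F (s + t p.2, φ (s + t p.2)))‖ ≤
      L * ‖φ (s + t p.1) - φ (s + t p.2)‖ + η := by
  have := isCompact_iff_compactSpace.1 hK
  have hc : IsCompact (Set.Icc (-ρ) ρ ×ˢ (Set.univ : Set K)) := isCompact_Icc.prod isCompact_univ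
  filter_upwards [hf ρ (η / 2) (by positivity),
    eventually_norm_sub_le_of_cauchy hF hc (half_pos hη)] with p h1 h2 s hs
  -- With the mixed term `F (s + t p.1, φ (s + t p.2))` inserted, the time shifts of `F` are
  -- compared only at a point of `K`, so the restriction of `F` to `ℝ × K` is enough.
  have h3 : ‖F (s + t p.1, φ (s + t p.2)) - F (s + t p.2, φ (s + t p.2))‖ ≤ η / 2 :=
    h2 (s, ⟨φ (s + t p.2), hφ _⟩) ⟨abs_le.1 hs, trivial⟩
  have h4 := (hLip (s + t p.1)).norm_sub_le (φ (s + t p.1)) (φ (s + t p.2))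
  have e : (f (s + t p.1) + F (s + t p.1, φ (s + t p.1))) -
      (f (s + t p.2) + F (s + t p.2, φ (s + t p.2))) = (f (s + t p.1) - f (s + t p.2)) +
      (F (s + t p.1, φ (s + t p.1)) - F (s + t p.1, φ (s + t p.2))) +
      (F (s + t p.1, φ (s + t p.2)) - F (s + t p.2, φ (s + t p.2))) := by abel
  rw [e]
  calc _ ≤ _ := norm_add_le _ _
    _ ≤ _ := add_le_add (norm_add_le _ _) le_rfl
    _ ≤ η / 2 + L * ‖φ (s + t p.1) - φ (s + t p.2)‖ + η / 2 :=
      add_le_add (add_le_add (h1 s hs) h4) h3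
    _ = _ := by ring

variable {𝕜 : Type*} [RCLike 𝕜] [NormedSpace ℝ E] [NormedSpace 𝕜 E] [IsScalarTower ℝ 𝕜 E]
  [CompleteSpace E]

/-- One improvement step for the asymptotic distance between shifts of a bounded solution. -/
theorem ExpTrichotomy.eventually_norm_sub_le {A : C(ℝ, E →L[𝕜] E)} {P Q : E →L[𝕜] E} {N ν : ℝ}
    (H : ExpTrichotomy A P Q N ν) {L : ℝ} (hL : 0 ≤ L) {q : ℝ} (hq : 2 * N / ν * L < q)
    {ψ g : ℝ → E} (hg : Continuous g) (hψ : ∀ s, HasDerivAt ψ (A s (ψ s) + g s) s)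
    {M : ℝ} (hM : ∀ s, ‖ψ s‖ ≤ M) {ι : Type*} {l : Filter ι} {t : ι → ℝ}
    (ht : Tendsto (fun i => |t i|) l atTop) (hA : LocallyCauchyAlong l t A)
    (hgψ : ∀ ρ η : ℝ, 0 < η → ∀ᶠ p in l ×ˢ l, ∀ s, |s| ≤ ρ →
      ‖g (s + t p.1) - g (s + t p.2)‖ ≤ L * ‖ψ (s + t p.1) - ψ (s + t p.2)‖ + η)
    {δ : ℝ} (hδ : 0 < δ)
    (hδψ : ∀ ρ, ∀ᶠ p in l ×ˢ l, ∀ s, |s| ≤ ρ → ‖ψ (s + t p.1) - ψ (s + t p.2)‖ ≤ δ) (ρ : ℝ) :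
    ∀ᶠ p in l ×ˢ l, ∀ s, |s| ≤ ρ → ‖ψ (s + t p.1) - ψ (s + t p.2)‖ ≤ q * δ := by
  have hN : 0 < N := zero_lt_one.trans_le H.one_le
  have hν := H.pos
  have hM0 : 0 ≤ M := (norm_nonneg _).trans (hM 0)
  have hψc : Continuous ψ := continuous_iff_continuousAt.2 fun s => (hψ s).continuousAt
  -- Half of the room between `2 * N / ν * L * δ` and `q * δ`: one half absorbs the boundary terms
  -- (choice of `T`), the other the variation of `A` and of the forcing (choice of `η`).
  set c : ℝ := (q - 2 * N / ν * L) * δ / 2 with hc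
  have hc0 : 0 < c := by
    have : 0 < q - 2 * N / ν * L := by linarith
    positivity
  obtain ⟨T, hT0, hT⟩ : ∃ T, 0 ≤ T ∧ 2 * N * Real.exp (-ν * T) * (2 * M) ≤ c := by
    have h1 : Tendsto (fun T => 2 * N * Real.exp (-ν * T) * (2 * M)) atTop
        (𝓝 (2 * N * 0 * (2 * M))) := by
      refine ((Real.tendsto_exp_atBot.comp ?_).const_mul _).mul_const _
      exact tendsto_id.const_mul_atTop_of_neg (neg_neg_of_pos hν)
    rw [mul_zero, zero_mul] at h1
    obtain ⟨T, h2, h3⟩ := ((h1.eventually (ge_mem_nhds hc0)).and (eventually_ge_atTop 0)).exists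
    exact ⟨T, h3, h2⟩
  obtain ⟨η, hη0, hη⟩ : ∃ η, 0 < η ∧ 2 * N / ν * (η * M + η) = c := by
    refine ⟨c * ν / (2 * N * (M + 1)), by positivity, ?_⟩
    field_simp
  -- The window is centred at `s + t p.1`, so only the first shift must be far from the origin. The
  -- hypotheses are taken on radius `ρ + T` because the window adds `T` to `|s| ≤ ρ`.
  have ht1 : ∀ᶠ p in l ×ˢ l, ρ + T ≤ |t p.1| :=
    (tendsto_fst.eventually (ht.eventually_ge_atTop (ρ + T)))
  filter_upwards [ht1, hA (ρ + T) η hη0, hgψ (ρ + T) η hη0, hδψ (ρ + T)] with p h1 h2 h3 h4 s hs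
  set a := t p.2 - t p.1 with ha
  have hadd : ∀ x, x + a = (x - t p.1) + t p.2 := fun x => by rw [ha]; ring
  have hsub : ∀ x, x = (x - t p.1) + t p.1 := fun x => by ring
  have hw : ∀ x, HasDerivAt (fun x => ψ x - ψ (x + a))
      (A x (ψ x - ψ (x + a)) + ((A x - A (x + a)) (ψ (x + a)) + (g x - g (x + a)))) x := by
    intro x
    refine ((hψ x).sub ((hψ (x + a)).comp_add_const x a)).congr_deriv ?_
    simp only [map_sub, sub_apply]
    abel
  have hr : T ≤ |s + t p.1| := by
    have := abs_sub_abs_le_abs_sub (t p.1) (-s)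
    rw [abs_neg, sub_neg_eq_add, add_comm (t p.1)] at this
    linarith
  have hest := H.norm_le hT0 hr (M := 2 * M) (δ := η * M + (L * δ + η)) hw
    (((A.continuous.sub (A.continuous.comp (by fun_prop))).clm_apply
      (hψc.comp (by fun_prop))).add (hg.sub (hg.comp (by fun_prop))))
    (fun x => (norm_sub_le _ _).trans (by linarith [hM x, hM (x + a)])) (fun x hx => ?_)
  · have e : s + t p.1 + a = s + t p.2 := by rw [ha]; ring
    simp only [e] at hest
    refine hest.trans ?_
    have : 2 * N / ν * (η * M + (L * δ + η)) = c + 2 * N / ν * L * δ := by rw [← hη]; ring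
    rw [this]
    have : q * δ = c + c + 2 * N / ν * L * δ := by rw [hc]; ring
    linarith
  · have hx' : |x - t p.1| ≤ ρ + T := by
      have e : x - t p.1 = s + (x - (s + t p.1)) := by ring
      rw [e]
      exact (abs_add_le _ _).trans (add_le_add hs hx)
    have k2 := h2 _ hx'
    have k3 := h3 _ hx'
    have k4 := h4 _ hx'
    rw [← hadd, ← hsub] at k2 k3 k4
    refine (norm_add_le _ _).trans (add_le_add ?_ ?_)
    · exact (ContinuousLinearMap.le_opNorm _ _).trans
        (mul_le_mul k2 (hM _) (norm_nonneg _) hη0.le)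
    · exact k3.trans (add_le_add (mul_le_mul_of_nonneg_left k4 hL) le_rfl)

/-- Convergence of the shifts of the data forces convergence of the shifts of a bounded
solution. -/
theorem ExpTrichotomy.locallyCauchyAlong {A : C(ℝ, E →L[𝕜] E)} {P Q : E →L[𝕜] E} {N ν : ℝ}
    (H : ExpTrichotomy A P Q N ν) {L : ℝ} (hL : 0 ≤ L) (hq : 2 * N / ν * L < 1)
    {ψ g : ℝ → E} (hg : Continuous g) (hψ : ∀ s, HasDerivAt ψ (A s (ψ s) + g s) s)
    {M : ℝ} (hM : ∀ s, ‖ψ s‖ ≤ M) {ι : Type*} {l : Filter ι} {t : ι → ℝ}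
    (ht : Tendsto (fun i => |t i|) l atTop) (hA : LocallyCauchyAlong l t A)
    (hgψ : ∀ ρ η : ℝ, 0 < η → ∀ᶠ p in l ×ˢ l, ∀ s, |s| ≤ ρ →
      ‖g (s + t p.1) - g (s + t p.2)‖ ≤ L * ‖ψ (s + t p.1) - ψ (s + t p.2)‖ + η) :
    LocallyCauchyAlong l t ψ := by
  have hN : 0 < N := zero_lt_one.trans_le H.one_le
  have hν := H.pos
  obtain ⟨q, hq1, hq2⟩ := exists_between hq
  have hq0 : 0 < q := lt_of_le_of_lt (by positivity) hq1
  have hM0 : 0 ≤ M := (norm_nonneg _).trans (hM 0)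
  -- The iteration starts from the trivial bound `2 * M`; the extra `1` keeps `δ` positive when `M =
  -- 0`.
  have key : ∀ k : ℕ, ∀ ρ, ∀ᶠ p in l ×ˢ l, ∀ s, |s| ≤ ρ →
      ‖ψ (s + t p.1) - ψ (s + t p.2)‖ ≤ q ^ k * (2 * M + 1) := by
    intro k
    induction k with
    | zero =>
      refine fun ρ => Eventually.of_forall fun p s _ => (norm_sub_le _ _).trans ?_
      linarith [hM (s + t p.1), hM (s + t p.2)]
    | succ k ih =>
      intro ρ
      rw [pow_succ', mul_assoc]
      exact H.eventually_norm_sub_le hL hq1 hg hψ hM ht hA hgψ (by positivity) ih ρ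
  intro ρ ε hε
  have hlim : Tendsto (fun k : ℕ => q ^ k * (2 * M + 1)) atTop (𝓝 (0 * (2 * M + 1))) :=
    (tendsto_pow_atTop_nhds_zero_of_lt_one hq0.le hq2).mul_const _
  rw [zero_mul] at hlim
  obtain ⟨k, hk⟩ := (hlim.eventually (ge_mem_nhds hε)).exists
  filter_upwards [key k ρ] with p hp s hs using (hp s hs).trans hk

end Comparison

/-! ### The contraction, stability of its fixed point, and remote compatibility -/

section Main

open scoped BoundedContinuousFunction

variable {E : Type*} [NormedAddCommGroup E]

theorem norm_superposition_le {f : C(ℝ, E)} {F : C(ℝ × E, E)} {L : NNReal}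
    (hF0 : ∀ t : ℝ, F (t, 0) = 0) (hLip : ∀ t : ℝ, LipschitzWith L (fun u : E => F (t, u)))
    {Mf M : ℝ} (hMf : ∀ t, ‖f t‖ ≤ Mf) {φ : ℝ → E} (hM : ∀ t, ‖φ t‖ ≤ M) (τ : ℝ) :
    ‖f τ + F (τ, φ τ)‖ ≤ Mf + L * M := by
  have h := (hLip τ).norm_sub_le (φ τ) 0
  rw [hF0, sub_zero, sub_zero] at h
  exact (norm_add_le _ _).trans
    (add_le_add (hMf τ) (h.trans (mul_le_mul_of_nonneg_left (hM τ) L.coe_nonneg)))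

variable {𝕜 : Type*} [RCLike 𝕜] [NormedSpace ℝ E] [NormedSpace 𝕜 E] [IsScalarTower ℝ 𝕜 E]
  [CompleteSpace E]
variable {A : C(ℝ, E →L[𝕜] E)} {f : C(ℝ, E)} {F : C(ℝ × E, E)} {P Q : E →L[𝕜] E} {N ν : ℝ}
  {L : NNReal}

theorem ExpTrichotomy.contraction_lt_one (H : ExpTrichotomy A P Q N ν)
    (hL : (L : ℝ) < ν / (2 * N)) : 2 * N / ν * L < 1 := by
  have hN : 0 < N := zero_lt_one.trans_le H.one_le
  have hν := H.pos
  rw [lt_div_iff₀ (by positivity)] at hL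
  rw [div_mul_eq_mul_div, div_lt_one hν]
  linarith

/-- The Green integral of `f + F(·, φ)` is Lagrange stable when `φ` is. -/
theorem ExpTrichotomy.lagrangeStable_integral_green (H : ExpTrichotomy A P Q N ν)
    (hF0 : ∀ t : ℝ, F (t, 0) = 0) (hLip : ∀ t : ℝ, LipschitzWith L (fun u : E => F (t, u)))
    (hA : LagrangeStable shift A) (hf : LagrangeStable shift f) (hF : LagrangeStable shiftTime F)
    {φ ψ : C(ℝ, E)} (hφ : LagrangeStable shift φ)
    (hψ : ∀ t, ψ t = ∫ τ, green A P Q t τ (f τ + F (τ, φ τ))) : LagrangeStable shift ψ := by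
  obtain ⟨M, hM⟩ := hφ.exists_norm_le
  obtain ⟨Mf, hMf⟩ := hf.exists_norm_le
  have hg : Continuous fun τ => f τ + F (τ, φ τ) := by fun_prop
  have hgM := norm_superposition_le hF0 hLip hMf hM
  refine .shift_of_locallyCauchyAlong fun l t ht => ?_
  obtain ⟨B, hB⟩ := hA.exists_tendsto l t
  obtain ⟨f', hf'⟩ := hf.exists_tendsto l t
  obtain ⟨φ', hφ'⟩ := hφ.exists_tendsto l t
  obtain ⟨F', hF'⟩ := (hF.restrictTo (closure (Set.range φ))).exists_tendsto l t
  have hcφ := LocallyCauchyAlong.of_cauchy hφ'.cauchy_map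
  have hd : ∀ s, HasDerivAt ψ (A s (ψ s) + (f s + F (s, φ s))) s := fun s => by
    rw [funext hψ]
    exact H.hasDerivAt_integral_green hg hgM s
  -- Here `φ` is already stable, so the forcing has Cauchy shifts along `l` by itself and the
  -- comparison is used with feedback constant `0`.
  refine H.locallyCauchyAlong le_rfl (by simp) hg hd
    (fun s => by rw [hψ]; exact H.norm_integral_green_le hgM s) ht (.of_cauchy hB.cauchy_map)
    fun ρ η hη => ?_
  filter_upwards [eventually_norm_superposition_sub_le hLip hφ.isCompact_closure_range
    (fun t => subset_closure ⟨t, rfl⟩) (.of_cauchy hf'.cauchy_map) hF'.cauchy_map ρ (η / 2)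
    (by positivity), hcφ ρ (η / (2 * (L + 1))) (by positivity)] with p h1 h2 s hs
  have h3 : (L : ℝ) * ‖φ (s + t p.1) - φ (s + t p.2)‖ ≤ η / 2 := by
    calc (L : ℝ) * ‖φ (s + t p.1) - φ (s + t p.2)‖
        ≤ (L + 1) * (η / (2 * (L + 1))) :=
          mul_le_mul (by linarith) (h2 s hs) (norm_nonneg _) (by positivity)
      _ = η / 2 := by field_simp
  rw [zero_mul, zero_add]
  linarith [h1 s hs]

/-- The Green operator `φ ↦ ∫ G(·, τ) (f(τ) + F(τ, φ(τ))) dτ` on bounded continuous functions. -/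
def ExpTrichotomy.greenMap (H : ExpTrichotomy A P Q N ν) (hF0 : ∀ t : ℝ, F (t, 0) = 0)
    (hLip : ∀ t : ℝ, LipschitzWith L (fun u : E => F (t, u)))
    {Mf : ℝ} (hMf : ∀ t, ‖f t‖ ≤ Mf) (φ : ℝ →ᵇ E) : ℝ →ᵇ E :=
  BoundedContinuousFunction.ofNormedAddCommGroup
    (fun t => ∫ τ, green A P Q t τ (f τ + F (τ, φ τ)))
    (continuous_iff_continuousAt.2 fun t => (H.hasDerivAt_integral_green (by fun_prop)
      (norm_superposition_le hF0 hLip hMf φ.norm_coe_le_norm) t).continuousAt)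
    (2 * N / ν * (Mf + L * ‖φ‖))
    (H.norm_integral_green_le (norm_superposition_le hF0 hLip hMf φ.norm_coe_le_norm))

theorem ExpTrichotomy.contractingWith_greenMap (H : ExpTrichotomy A P Q N ν)
    (hF0 : ∀ t : ℝ, F (t, 0) = 0) (hLip : ∀ t : ℝ, LipschitzWith L (fun u : E => F (t, u)))
    {Mf : ℝ} (hMf : ∀ t, ‖f t‖ ≤ Mf) (hL : (L : ℝ) < ν / (2 * N)) :
    ContractingWith (2 * N / ν * L).toNNReal (H.greenMap hF0 hLip hMf) := by
  have hN : 0 < N := zero_lt_one.trans_le H.one_le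
  have hν := H.pos
  have hq : 0 ≤ 2 * N / ν * L := by positivity
  refine ⟨by simpa using H.contraction_lt_one hL, LipschitzWith.of_dist_le_mul fun φ ψ => ?_⟩
  rw [Real.coe_toNNReal _ hq]
  refine (BoundedContinuousFunction.dist_le (by positivity)).2 fun t => ?_
  rw [dist_eq_norm]
  have hi := fun χ : ℝ →ᵇ E => H.integrable_green (g := fun τ => f τ + F (τ, χ τ)) (by fun_prop)
    (norm_superposition_le hF0 hLip hMf χ.norm_coe_le_norm) t
  change ‖(∫ τ, green A P Q t τ (f τ + F (τ, φ τ))) - ∫ τ, green A P Q t τ (f τ + F (τ, ψ τ))‖ ≤ _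
  rw [← MeasureTheory.integral_sub (hi φ) (hi ψ), mul_assoc]
  simp only [← map_sub]
  refine H.norm_integral_green_le (fun τ => ?_) t
  rw [add_sub_add_left_eq_sub]
  refine ((hLip τ).norm_sub_le (φ τ) (ψ τ)).trans (mul_le_mul_of_nonneg_left ?_ L.coe_nonneg)
  rw [← dist_eq_norm]
  exact BoundedContinuousFunction.dist_coe_le_dist τ

/-- The comparison argument needs values in a compact set, which is not known beforehand for the
fixed point. The iterates starting at `0` have this property inductively, and they converge
uniformly on `ℝ`. -/
theorem ExpTrichotomy.lagrangeStable_fixedPoint (H : ExpTrichotomy A P Q N ν)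
    (hF0 : ∀ t : ℝ, F (t, 0) = 0) (hLip : ∀ t : ℝ, LipschitzWith L (fun u : E => F (t, u)))
    {Mf : ℝ} (hMf : ∀ t, ‖f t‖ ≤ Mf) (hL : (L : ℝ) < ν / (2 * N))
    (hA : LagrangeStable shift A) (hf : LagrangeStable shift f) (hF : LagrangeStable shiftTime F) :
    LagrangeStable shift
      (ContractingWith.fixedPoint _ (H.contractingWith_greenMap hF0 hLip hMf hL)).toContinuousMap := by
  have hT := H.contractingWith_greenMap hF0 hLip hMf hL
  have hit : ∀ n : ℕ,
      LagrangeStable shift ((H.greenMap hF0 hLip hMf)^[n] 0).toContinuousMap := by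
    intro n
    induction n with
    | zero => exact lagrangeStable_shift_zero
    | succ n ih =>
      rw [Function.iterate_succ_apply']
      exact H.lagrangeStable_integral_green hF0 hLip hA hf hF ih fun _ => rfl
  refine .of_uniform_approx fun ε hε => ?_
  obtain ⟨n, hn⟩ := (Metric.tendsto_atTop.1 (hT.tendsto_iterate_fixedPoint 0) ε hε)
  refine ⟨_, hit n, fun t => ?_⟩
  have := (BoundedContinuousFunction.dist_coe_le_dist t).trans (hn n le_rfl).le
  rwa [dist_comm, dist_eq_norm] at this

theorem IsGreenSolution.hasDerivAt {φ : C(ℝ, E)} (hφ : IsGreenSolution A P Q f F φ)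
    (H : ExpTrichotomy A P Q N ν) {M : ℝ} (hM : ∀ τ, ‖f τ + F (τ, φ τ)‖ ≤ M) (t : ℝ) :
    HasDerivAt φ (A t (φ t) + (f t + F (t, φ t))) t := by
  have h := H.hasDerivAt_integral_green (g := fun τ => f τ + F (τ, φ τ)) (by fun_prop) hM t
  rwa [← funext fun t => (hφ t).2, ← (hφ t).2] at h

/-- Now `closure (Set.range φ)` is compact, so the comparison applies with the true feedback
constant `L`: convergence of the data alone forces the shifts of `φ` to be Cauchy. -/
theorem IsGreenSolution.remotelyCompatible {φ : C(ℝ, E)} (hφ : IsGreenSolution A P Q f F φ)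
    (H : ExpTrichotomy A P Q N ν) (hF0 : ∀ t : ℝ, F (t, 0) = 0)
    (hLip : ∀ t : ℝ, LipschitzWith L (fun u : E => F (t, u))) (hL : (L : ℝ) < ν / (2 * N))
    (hf : LagrangeStable shift f) (hφs : LagrangeStable shift φ) :
    RemotelyCompatible A f F φ := by
  obtain ⟨M, hM⟩ := hφs.exists_norm_le
  obtain ⟨Mf, hMf⟩ := hf.exists_norm_le
  have hgM := norm_superposition_le hF0 hLip hMf hM
  rintro t ⟨ht, ⟨B, f', F'⟩, hlim⟩
  have hB : Tendsto (fun n => shift (t n) A) atTop (𝓝 B) := hlim.fst_nhds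
  have hf' : Tendsto (fun n => shift (t n) f) atTop (𝓝 f') := hlim.snd_nhds.fst_nhds
  have hF' : Tendsto (fun n => shiftTime (t n) (restrictTo (closure (Set.range φ)) F)) atTop
    (𝓝 F') := hlim.snd_nhds.snd_nhds
  have habs : Tendsto (fun n => |t n|) atTop atTop :=
    ht.elim tendsto_abs_atTop_atTop.comp tendsto_abs_atBot_atTop.comp
  refine ⟨ht, cauchySeq_tendsto_of_complete (LocallyCauchyAlong.cauchy ?_)⟩
  exact H.locallyCauchyAlong L.coe_nonneg (H.contraction_lt_one hL) (by fun_prop)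
    (hφ.hasDerivAt H hgM) hM habs (.of_cauchy hB.cauchy_map)
    (eventually_norm_superposition_sub_le hLip hφs.isCompact_closure_range
      (fun t => subset_closure ⟨t, rfl⟩) (.of_cauchy hf'.cauchy_map) hF'.cauchy_map)

end Main

end RemoteCompat

end

theorem theorem6p4 {𝕜 E : Type*} [RCLike 𝕜] [NormedAddCommGroup E] [NormedSpace ℝ E]
    [NormedSpace 𝕜 E] [IsScalarTower ℝ 𝕜 E] [CompleteSpace E]
    (A : C(ℝ, E →L[𝕜] E)) (f : C(ℝ, E)) (F : C(ℝ × E, E))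
    (P Q : E →L[𝕜] E) (N ν : ℝ) (L : NNReal)
    (hF0 : ∀ t : ℝ, F (t, 0) = 0)
    (htri : RemoteCompat.ExpTrichotomy A P Q N ν)
    (hC : RemoteCompat.ConditionC A P)
    (hA : RemoteCompat.LagrangeStable RemoteCompat.shift A)
    (hf : RemoteCompat.LagrangeStable RemoteCompat.shift f)
    (hF : RemoteCompat.LagrangeStable RemoteCompat.shiftTime F)
    (hLip : ∀ t : ℝ, LipschitzWith L (fun u : E => F (t, u)))
    (hL : (L : ℝ) < ν / (2 * N)) :
    (∃! φ : C(ℝ, E), RemoteCompat.LagrangeStable RemoteCompat.shift φ ∧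
      RemoteCompat.IsGreenSolution A P Q f F φ) ∧
    ∀ φ : C(ℝ, E), RemoteCompat.LagrangeStable RemoteCompat.shift φ →
      RemoteCompat.IsGreenSolution A P Q f F φ →
      RemoteCompat.IsSolution A f F φ ∧ RemoteCompat.RemotelyCompatible A f F φ := by
  obtain ⟨Mf, hMf⟩ := hf.exists_norm_le
  have hT := htri.contractingWith_greenMap hF0 hLip hMf hL
  refine ⟨⟨(ContractingWith.fixedPoint _ hT).toContinuousMap,
    ⟨htri.lagrangeStable_fixedPoint hF0 hLip hMf hL hA hf hF, fun t => ⟨?_, ?_⟩⟩, ?_⟩, ?_⟩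
  · exact htri.integrable_green (by fun_prop) (RemoteCompat.norm_superposition_le hF0 hLip hMf
      (ContractingWith.fixedPoint _ hT).norm_coe_le_norm) t
  · exact (DFunLike.congr_fun hT.fixedPoint_isFixedPt.symm t)
  · rintro ψ ⟨hψs, hψ⟩
    -- A Lagrange stable function is bounded, so any competitor is a fixed point of the same
    -- contraction.
    obtain ⟨M, hM⟩ := hψs.exists_norm_le
    have h := hT.fixedPoint_unique
      (x := BoundedContinuousFunction.ofNormedAddCommGroup ψ ψ.continuous M hM)
      (BoundedContinuousFunction.ext fun t => ((hψ t).2).symm)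
    rw [← h]
    rfl
  · intro φ hφs hφ
    obtain ⟨M, hM⟩ := hφs.exists_norm_le
    refine ⟨fun t => ?_, hφ.remotelyCompatible htri hF0 hLip hL hf hφs⟩
    rw [add_assoc]
    exact hφ.hasDerivAt htri (RemoteCompat.norm_superposition_le hF0 hLip hMf hM) t
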